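/- An \emph{$\omega$-semigroup} is a two-sorted set $A=(A_+,A_\omega)$ with a binary product $A_+\times A_+\to A_+$, a mixed product $A_+\times A_\omega\to A_\omega$ and an infinite product $\pi\colon A_+^{\mathbb N}\to A_\omega$ such that $(ab)c=a(bc)$, $(ab)z=a(bz)$, $\pi(a_0,a_1,\ldots)=a_0\,\pi(a_1,a_2,\ldots)$, and $\pi(a_0,a_1,\ldots)=\pi(a_0\cdots a_{k_0-1},\,a_{k_0}\cdots a_{k_1-1},\ldots)$ for all $0<k_0<k_1<\cdots$. Morphisms are two-sorted maps preserving all finite and infinite products. $A$ is \emph{finite} if both sorts are, and \emph{complete} if $\pi$ is surjective. For a finite alphabet $\Sigma$, nonempty finite words and infinite words form an $\omega$-semigroup $(\Sigma^+,\Sigma^\omega)$ under concatenation. An \emph{$\infty$-language} over $\Sigma$ is a subset $L\subseteq\Sigma^+\cup\Sigma^\omega$. It is \emph{recognized} by a morphism $h\colon(\Sigma^+,\Sigma^\omega)\to A$ if $L=h^{-1}[Y]$ for some two-sorted subset $Y\subseteq A$, and it is \emph{regular} if it is recognized by a morphism into some finite $\omega$-semigroup. A \emph{local variety of $\infty$-languages}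 over $\Sigma$ is a set of regular $\infty$-languages over $\Sigma$ that is closed under the boolean operations (including the empty and the full language) and under the derivatives \[ \begin{aligned} y^{-1}L&=\{x\in\Sigma^+: yx\in L\}, & Ly^{-1}&=\{x\in\Sigma^+: xy\in L\}, & Lz^{-1}&=\{x\in\Sigma^+: xz\in L\},\\ \omega^{-1}L&=\{x\in\Sigma^+: x^\omega\in L\}, & y^{-1}L_\omega&=\{z\in\Sigma^\omega: yz\in L\} \end{aligned} \] for $y\in\Sigma^*$, $z\in\Sigma^\omega$. A \emph{variety of $\infty$-languages} is a family $(W_\Sigma)$ of local varieties, $\Sigma$ ranging over all finite alphabets, such that $L\in W_\Sigma$ implies $g^{-1}L\in W_\Delta$ for every $\omega$-semigroup morphism $g\colon(\Delta^+,\Delta^\omega)\to(\Sigma^+,\Sigma^\omega)$. A \emph{$\Sigma$-generated finite $\omega$-semigroup} is a surjective morphism $e\colon(\Sigma^+,\Sigma^\omega)\twoheadrightarrow A$ with $A$ finite; put $e\le e'$ if $e$ factorizes through $e'$, and identify $e,e'$ if $e\le e'\le e$. A \emph{local pseudovariety of $\Sigma$-generated $\omega$-semigroups} is a nonempty class of such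 quotients that is downwards closed and directed with respect to $\le$ (equivalently, closed under quotients and subdirect products). A \emph{pseudovariety of $\omega$-semigroups} is a class of finite complete $\omega$-semigroups closed under quotients, complete $\omega$-subsemigroups and finite products (including the empty one). \textbf{Theorem.} (1) For every finite alphabet $\Sigma$, the local varieties of $\infty$-languages over $\Sigma$ and the local pseudovarieties of $\Sigma$-generated $\omega$-semigroups, ordered by inclusion, form isomorphic lattices; an isomorphism sends a local pseudovariety $\mathcal P$ to the set of all $\infty$-languages recognized by some $e\in\mathcal P$. (2) The varieties of $\infty$-languages and the pseudovarieties of $\omega$-semigroups, ordered by inclusion, form isomorphic lattices; an isomorphism sends a pseudovariety $\mathcal V$ to the family $(W_\Sigma)$ where $W_\Sigma$ is the set of all $\infty$-languages recognized by some morphism $(\Sigma^+,\Sigma^\omega)\to A$ with $A\in\mathcal V$. -/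

import Mathlib

universe u

namespace InftyLang

/-! ### Finite segments of a sequence in a semigroup -/

/-- `block a m l` is the product `a m * a (m + 1) * ⋯ * a (m + l)` of `l + 1` factors. -/
def block {S : Type u} [Mul S] (a : ℕ → S) (m : ℕ) : ℕ → S
  | 0 => a m
  | l + 1 => block a m l * a (m + (l + 1))

/-- For `m < n`, `segProd a m n` is the product `a m * a (m + 1) * ⋯ * a (n - 1)`. -/
def segProd {S : Type u} [Mul S] (a : ℕ → S) (m n : ℕ) : S :=
  block a m (n - m - 1)

theorem block_succ_left {S : Type u} [Semigroup S] (a : ℕ → S) (l : ℕ) :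
    block a 0 (l + 1) = a 0 * block (fun n => a (n + 1)) 0 l := by
  induction l with
  | zero => simp [block]
  | succ l ih => rw [block, ih, block, mul_assoc]; simp

theorem block_add {S : Type u} [Semigroup S] (a : ℕ → S) (m l r : ℕ) :
    block a m l * block a (m + (l + 1)) r = block a m (l + r + 1) := by
  induction r with
  | zero => simp [block]
  | succ r ih =>
    rw [block, ← mul_assoc, ih, show l + (r + 1) + 1 = (l + r + 1) + 1 by omega, block]
    congr 2
    omega

theorem block_segProd {S : Type u} [Semigroup S] (a : ℕ → S) (k : ℕ → ℕ) (h0 : k 0 = 0)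
    (hk : StrictMono k) (n : ℕ) :
    block (fun i => segProd a (k i) (k (i + 1))) 0 n = block a 0 (k (n + 1) - 1) := by
  induction n with
  | zero => simp [block, segProd, h0]
  | succ n ih =>
    have h1 : k (n + 1) < k (n + 2) := hk (by omega)
    have h2 : k 0 < k (n + 1) := hk (by omega)
    rw [block, ih, zero_add, segProd]
    conv_lhs =>
      rw [show block a (k (n + 1)) = block a (0 + ((k (n + 1) - 1) + 1)) by congr 1; omega]
    rw [block_add]
    have h3 : k (n + 1 + 1) = k (n + 2) := rfl
    congr 1
    omega

/-! ### ω-semigroups -/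

/-- An ω-semigroup `A = (A₊, A_ω)`. In the last law the infinite sequence is cut into the
consecutive nonempty blocks `[k 0, k 1), [k 1, k 2), …` where `0 = k 0 < k 1 < k 2 < ⋯`. -/
structure OmegaSemigroup : Type (u + 1) where
  /-- the sort `A₊` -/
  Pos : Type u
  /-- the sort `A_ω` -/
  Inf : Type u
  /-- the binary product `A₊ × A₊ → A₊` and its associative law -/
  [semigroup : Semigroup Pos]
  /-- the mixed product `A₊ × A_ω → A_ω` and its associative law -/
  [action : SemigroupAction Pos Inf]
  /-- the infinite product `π : A₊^ω → A_ω` -/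
  iprod : (ℕ → Pos) → Inf
  iprod_cons : ∀ a : ℕ → Pos, iprod a = a 0 • iprod (fun n => a (n + 1))
  iprod_segProd : ∀ (a : ℕ → Pos) (k : ℕ → ℕ), k 0 = 0 → StrictMono k →
    iprod a = iprod (fun i => segProd a (k i) (k (i + 1)))

attribute [instance] OmegaSemigroup.semigroup OmegaSemigroup.action

namespace OmegaSemigroup

/-- Both sorts are finite. -/
def IsFinite (A : OmegaSemigroup.{u}) : Prop := Finite A.Pos ∧ Finite A.Inf

/-- Every element of `A_ω` is an infinite product of elements of `A₊`. -/
def IsComplete (A : OmegaSemigroup.{u}) : Prop := Function.Surjective A.iprod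

/-- Morphisms of ω-semigroups: two-sorted maps preserving all products. -/
structure Hom (A B : OmegaSemigroup.{u}) where
  pos : A.Pos → B.Pos
  inf : A.Inf → B.Inf
  map_mul : ∀ x y, pos (x * y) = pos x * pos y
  map_smul : ∀ x z, inf (x • z) = pos x • inf z
  map_iprod : ∀ a : ℕ → A.Pos, inf (A.iprod a) = B.iprod (fun n => pos (a n))

/-- The morphism is surjective in both sorts. -/
def Hom.IsSurjective {A B : OmegaSemigroup.{u}} (h : Hom A B) : Prop :=
  Function.Surjective h.pos ∧ Function.Surjective h.inf

/-- The morphism is injective in both sorts. -/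
def Hom.IsInjective {A B : OmegaSemigroup.{u}} (h : Hom A B) : Prop :=
  Function.Injective h.pos ∧ Function.Injective h.inf

theorem block_apply {ι : Type u} (A : ι → OmegaSemigroup.{u}) (a : ℕ → ∀ i, (A i).Pos)
    (m l : ℕ) (i : ι) : block a m l i = block (fun n => a n i) m l := by
  induction l with
  | zero => rfl
  | succ l ih => simp [block, ih]

/-- The product of a family of ω-semigroups, with componentwise operations. -/
def pi {ι : Type u} (A : ι → OmegaSemigroup.{u}) : OmegaSemigroup.{u} where
  Pos := ∀ i, (A i).Pos
  Inf := ∀ i, (A i).Inf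
  semigroup := Pi.semigroup
  action :=
    { smul := fun x z i => x i • z i
      mul_smul := fun x y z => funext fun i => SemigroupAction.mul_smul (x i) (y i) (z i) }
  iprod := fun a i => (A i).iprod (fun n => a n i)
  iprod_cons := fun a => funext fun i => (A i).iprod_cons (fun n => a n i)
  iprod_segProd := fun a k h0 hk => funext fun i => by
    rw [(A i).iprod_segProd (fun n => a n i) k h0 hk]
    simp only [segProd, block_apply]

/-! ### Multiplication by elements of `A₊ ∪ {1}`, where `none` plays the role of `1` -/

/-- `x ↦ y x` on `A₊` for `y ∈ A₊ ∪ {1}` -/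
def lmul (A : OmegaSemigroup.{u}) : Option A.Pos → A.Pos → A.Pos
  | none, x => x
  | some y, x => y * x

/-- `x ↦ x y` on `A₊` for `y ∈ A₊ ∪ {1}` -/
def rmul (A : OmegaSemigroup.{u}) : A.Pos → Option A.Pos → A.Pos
  | x, none => x
  | x, some y => x * y

/-- `z ↦ y z` on `A_ω` for `y ∈ A₊ ∪ {1}` -/
def lact (A : OmegaSemigroup.{u}) : Option A.Pos → A.Inf → A.Inf
  | none, z => z
  | some y, z => y • z

/-- `x ↦ x^ω = π(x, x, x, …)` -/
def omegaPow (A : OmegaSemigroup.{u}) (x : A.Pos) : A.Inf := A.iprod (fun _ => x)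

end OmegaSemigroup

/-! ### The ω-semigroup `(α⁺, α^ω)` of nonempty finite and of infinite words over `α` -/

section Words

variable {α : Type u}

/-- The list of letters of a nonempty finite word. -/
def letters (x : FreeSemigroup α) : List α := x.head :: x.tail

theorem letters_mul (x y : FreeSemigroup α) : letters (x * y) = letters x ++ letters y := rfl

theorem letters_length_pos (x : FreeSemigroup α) : 0 < (letters x).length := by
  simp [letters]

theorem lt_length_block (w : ℕ → FreeSemigroup α) (m n : ℕ) :
    n < (letters (block w m n)).length := by
  induction n with
  | zero => exact letters_length_pos _
  | succ n ih =>
    rw [block, letters_mul, List.length_append]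
    have := letters_length_pos (w (m + (n + 1)))
    omega

/-- The concatenation `x z` of a finite word `x` with an infinite word `z`. -/
def prepend (x : FreeSemigroup α) (z : ℕ → α) : ℕ → α := fun n =>
  if h : n < (letters x).length then (letters x)[n] else z (n - (letters x).length)

/-- The infinite concatenation `w₀ w₁ w₂ ⋯` of nonempty finite words: its `n`-th letter is the
`n`-th letter of the word `w₀ w₁ ⋯ wₙ`, whose length exceeds `n`. -/
def infConcat (w : ℕ → FreeSemigroup α) : ℕ → α := fun n =>
  (letters (block w 0 n))[n]'(lt_length_block w 0 n)

/-- The finite word `x` is a prefix of the infinite word `z`. -/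
def IsPrefixOf (x : FreeSemigroup α) (z : ℕ → α) : Prop :=
  ∀ (i : ℕ) (h : i < (letters x).length), z i = (letters x)[i]

theorem letters_block_prefix (w : ℕ → FreeSemigroup α) {m n : ℕ} (h : m ≤ n) :
    letters (block w 0 m) <+: letters (block w 0 n) := by
  induction n, h using Nat.le_induction with
  | base => exact List.prefix_rfl
  | succ n _ ih => exact ih.trans (by rw [block, letters_mul]; exact List.prefix_append _ _)

theorem isPrefixOf_infConcat (w : ℕ → FreeSemigroup α) (n : ℕ) :
    IsPrefixOf (block w 0 n) (infConcat w) := by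
  intro i h
  rcases le_total i n with hi | hi
  · exact (letters_block_prefix w hi).getElem _
  · exact ((letters_block_prefix w hi).getElem _).symm

theorem eq_infConcat {w : ℕ → FreeSemigroup α} {z : ℕ → α}
    (h : ∀ n, IsPrefixOf (block w 0 n) z) : z = infConcat w :=
  funext fun n => h n n (lt_length_block w 0 n)

theorem prepend_mul (x y : FreeSemigroup α) (z : ℕ → α) :
    prepend (x * y) z = prepend x (prepend y z) := by
  funext n
  simp only [prepend, letters_mul, List.length_append, List.getElem_append]
  split_ifs <;> first | rfl | omega | (congr 1; omega)

theorem infConcat_cons (w : ℕ → FreeSemigroup α) :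
    infConcat w = prepend (w 0) (infConcat (fun n => w (n + 1))) := by
  refine (eq_infConcat fun n => ?_).symm
  cases n with
  | zero =>
    intro i h
    simp only [block] at h ⊢
    simp [prepend, h]
  | succ n =>
    rw [block_succ_left]
    intro i h
    simp only [letters_mul, List.length_append] at h
    simp only [prepend, letters_mul, List.getElem_append]
    split_ifs with h'
    · rfl
    · exact isPrefixOf_infConcat (fun n => w (n + 1)) n _ (by omega)

theorem infConcat_segProd (w : ℕ → FreeSemigroup α) (k : ℕ → ℕ) (h0 : k 0 = 0)
    (hk : StrictMono k) :
    infConcat w = infConcat (fun i => segProd w (k i) (k (i + 1))) := by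
  refine eq_infConcat fun n => ?_
  rw [block_segProd w k h0 hk]
  exact isPrefixOf_infConcat w _

variable (α)

/-- The ω-semigroup `(α⁺, α^ω)`, with products given by concatenation of words. -/
def words : OmegaSemigroup.{u} where
  Pos := FreeSemigroup α
  Inf := ℕ → α
  semigroup := inferInstance
  action := { smul := prepend, mul_smul := prepend_mul }
  iprod := infConcat
  iprod_cons := infConcat_cons
  iprod_segProd := infConcat_segProd

/-- ∞-languages `L ⊆ α⁺ ∪ α^ω`, given by their two components `L.1 ⊆ α⁺` and `L.2 ⊆ α^ω`;
the boolean operations are componentwise. -/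
abbrev InfLanguage : Type u := Set (words α).Pos × Set (words α).Inf

end Words

namespace InfLanguage

open OmegaSemigroup

variable {α β : Type u}

/-- The preimage of an ∞-language under a morphism `g : (β⁺, β^ω) → (α⁺, α^ω)`. -/
def preimage (g : Hom (words β) (words α)) (L : InfLanguage α) : InfLanguage β :=
  (g.pos ⁻¹' L.1, g.inf ⁻¹' L.2)

/-- `h : (α⁺, α^ω) → A` recognizes `L`: one has `L = h⁻¹[Y]` for some two-sorted `Y ⊆ A`. -/
def IsRecognizedBy (L : InfLanguage α) {A : OmegaSemigroup.{u}} (h : Hom (words α) A) : Prop :=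
  ∃ (Y : Set A.Pos) (Z : Set A.Inf), L = (h.pos ⁻¹' Y, h.inf ⁻¹' Z)

/-- Regular (= recognizable) ∞-languages: recognized by a morphism into a finite ω-semigroup. -/
def IsRegular (L : InfLanguage α) : Prop :=
  ∃ A : OmegaSemigroup.{u}, A.IsFinite ∧ ∃ h : Hom (words α) A, L.IsRecognizedBy h

/-- `y⁻¹L = {x ∈ α⁺ | y x ∈ L}` for `y ∈ α⁺ ∪ {1}` -/
def leftDeriv (y : Option (words α).Pos) (L : InfLanguage α) : InfLanguage α :=
  ({x | (words α).lmul y x ∈ L.1}, ∅)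

/-- `Ly⁻¹ = {x ∈ α⁺ | x y ∈ L}` for `y ∈ α⁺ ∪ {1}` -/
def rightDeriv (L : InfLanguage α) (y : Option (words α).Pos) : InfLanguage α :=
  ({x | (words α).rmul x y ∈ L.1}, ∅)

/-- `Lz⁻¹ = {x ∈ α⁺ | x z ∈ L}` for `z ∈ α^ω` -/
def infDeriv (L : InfLanguage α) (z : (words α).Inf) : InfLanguage α :=
  ({x | x • z ∈ L.2}, ∅)

/-- `ω⁻¹L = {x ∈ α⁺ | x^ω ∈ L}` -/
def omegaDeriv (L : InfLanguage α) : InfLanguage α :=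
  ({x | (words α).omegaPow x ∈ L.2}, ∅)

/-- `y⁻¹L_ω = {z ∈ α^ω | y z ∈ L}` for `y ∈ α⁺ ∪ {1}` -/
def leftDerivInf (y : Option (words α).Pos) (L : InfLanguage α) : InfLanguage α :=
  (∅, {z | (words α).lact y z ∈ L.2})

end InfLanguage

open OmegaSemigroup

/-! ### Varieties of ∞-languages -/

/-- A boolean algebra of regular ∞-languages over `α` closed under all derivatives. -/
structure IsLocalVariety {α : Type u} (W : BooleanSubalgebra (InfLanguage α)) : Prop where
  regular : ∀ L ∈ W, L.IsRegular
  leftDeriv : ∀ L ∈ W, ∀ y, InfLanguage.leftDeriv y L ∈ W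
  rightDeriv : ∀ L ∈ W, ∀ y, InfLanguage.rightDeriv L y ∈ W
  infDeriv : ∀ L ∈ W, ∀ z, InfLanguage.infDeriv L z ∈ W
  omegaDeriv : ∀ L ∈ W, InfLanguage.omegaDeriv L ∈ W
  leftDerivInf : ∀ L ∈ W, ∀ y, InfLanguage.leftDerivInf y L ∈ W

/-- Local varieties of ∞-languages over `α`, ordered by inclusion. -/
abbrev LocalVariety (α : Type u) : Type u :=
  {W : BooleanSubalgebra (InfLanguage α) // IsLocalVariety W}

/-- Finite alphabets. -/
abbrev Alphabet : Type (u + 1) := {α : Type u // Finite α}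

/-- A family of local varieties, one for each finite alphabet, closed under preimages of
morphisms of ω-semigroups. -/
def IsVariety (W : ∀ α : Alphabet.{u}, LocalVariety α.1) : Prop :=
  ∀ (α β : Alphabet.{u}) (g : Hom (words β.1) (words α.1)),
    ∀ L ∈ (W α).1, L.preimage g ∈ (W β).1

/-- Varieties of ∞-languages, ordered by inclusion at every alphabet. -/
abbrev Variety : Type (u + 1) :=
  {W : ∀ α : Alphabet.{u}, LocalVariety α.1 // IsVariety W}

/-! ### Pseudovarieties of ω-semigroups -/

/-- An `α`-generated finite ω-semigroup: a quotient `e : (α⁺, α^ω) ↠ A` with `A` finite. -/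
structure GeneratedAlgebra (α : Type u) : Type (u + 1) where
  alg : OmegaSemigroup.{u}
  finite : alg.IsFinite
  map : Hom (words α) alg
  surjective : map.IsSurjective

/-- `e ≤ e'` iff `e` factorizes through `e'`. Quotients with `e ≤ e' ≤ e` are isomorphic; every
lower set of this preorder is closed under isomorphism. -/
instance {α : Type u} : Preorder (GeneratedAlgebra α) where
  le e e' := ∃ q : Hom e'.alg e.alg,
    (∀ x, e.map.pos x = q.pos (e'.map.pos x)) ∧ ∀ z, e.map.inf z = q.inf (e'.map.inf z)
  le_refl e := ⟨⟨id, id, fun _ _ => rfl, fun _ _ => rfl, fun _ => rfl⟩, fun _ => rfl, fun _ => rfl⟩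
  le_trans := by
    rintro a b c ⟨q, hq, hq'⟩ ⟨r, hr, hr'⟩
    refine ⟨⟨q.pos ∘ r.pos, q.inf ∘ r.inf, fun x y => ?_, fun x z => ?_, fun s => ?_⟩,
      fun x => ?_, fun z => ?_⟩
    · simp [r.map_mul, q.map_mul]
    · simp [r.map_smul, q.map_smul]
    · simp [r.map_iprod, q.map_iprod]
    · simp [hq, hr]
    · simp [hq', hr']

/-- Local pseudovarieties of `α`-generated finite ω-semigroups: the nonempty, downwards closed
(= closed under quotients) and directed (= closed under subdirect products) classes,
ordered by inclusion. -/
abbrev LocalPseudovariety (α : Type u) : Type (u + 1) := Order.Ideal (GeneratedAlgebra α)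

/-- A class of finite complete ω-semigroups closed under quotients, complete
ω-subsemigroups and finite products. -/
structure IsPseudovariety (V : Set OmegaSemigroup.{u}) : Prop where
  finite : ∀ A ∈ V, A.IsFinite
  complete : ∀ A ∈ V, A.IsComplete
  quotient : ∀ A ∈ V, ∀ (B : OmegaSemigroup.{u}) (q : Hom A B), q.IsSurjective → B ∈ V
  sub : ∀ A ∈ V, ∀ (B : OmegaSemigroup.{u}) (m : Hom B A), m.IsInjective → B.IsComplete → B ∈ V
  prod : ∀ (ι : Type u) [Finite ι] (A : ι → OmegaSemigroup.{u}), (∀ i, A i ∈ V) →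
    OmegaSemigroup.pi A ∈ V

/-- Pseudovarieties of ω-semigroups, ordered by inclusion. -/
abbrev Pseudovariety : Type (u + 1) := {V : Set OmegaSemigroup.{u} // IsPseudovariety V}

/-- The partially ordered type `P` is a lattice. -/
def IsLatticeOrder (P : Type*) [PartialOrder P] : Prop :=
  ∀ a b : P, (∃ c, IsLUB {a, b} c) ∧ ∃ c, IsGLB {a, b} c

end InftyLang

namespace InftyLang

open OmegaSemigroup Filter

/-! ### A Ramsey argument -/

/-! In both parts the inverse map sends `W` to the algebras (or quotients) that recognize only
members of `W` (`Admits`). Recognition depends only on the kernel of a morphism, so most arguments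
compare kernels through `Refines`.

Recovering `W`: a language `L` in `W` needs a finite quotient that recognizes it and admits only
members of `W`. Let `h` be a morphism into a finite ω-semigroup recognizing `L`, and identify words
that no member of `W` recognized by `h` distinguishes. Finitely many languages separate the classes,
so every union of classes is a Boolean combination of them and lies in `W` (`mem_of_separated`).
Derivatives give compatibility with the binary and mixed products. Infinite products are the crux:
Ramsey's theorem replaces two of them, up to `h`, by `s e^ω` and `s' e'^ω` cut at the same places
(`exists_common_factorization`), and then the ω-derivative suffices.

Recovering the algebras: a morphism into a finite ω-semigroup is controlled by the inverse images of
its finitely many points (`refines_of_isRecognizedBy`). Each is recognized by some member of the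
class. Directedness, or a finite product, provides one member recognizing them all, and the given
morphism factors through it or through its image.

The global part also uses freeness of `(α⁺, α^ω)`: morphisms from it lift along surjections, and a
finite complete ω-semigroup is a quotient of the words over its own first sort. -/

theorem exists_strictMono_monochromatic {C : Type*} [Finite C] (f : ℕ → ℕ → C) :
    ∃ (k : ℕ → ℕ) (c : C), 0 < k 0 ∧ StrictMono k ∧ ∀ i, f (k i) (k (i + 1)) = c := by
  -- Ramsey by a nonprincipal ultrafilter: `d m` is the limit colour of row `m`, and `c` is the
  -- limit of `d`. From any `m` with `d m = c`, ultrafilter-many `n` satisfy both `f m n = c` and `d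
  -- n = c`, so the chain never stops.
  have hlim : ∀ g : ℕ → C, ∃ c, ∀ᶠ n in (hyperfilter ℕ : Filter ℕ), g n = c := by
    intro g
    obtain ⟨c, hc⟩ := ((hyperfilter ℕ).map g).eq_pure_of_finite
    refine ⟨c, ?_⟩
    have h : ({c} : Set C) ∈ (hyperfilter ℕ).map g := by
      rw [hc]
      exact Ultrafilter.mem_pure.2 rfl
    exact h
  choose d hd using fun m => hlim (f m)
  obtain ⟨c, hc⟩ := hlim d
  have hgt : ∀ m : ℕ, ∀ᶠ n in (hyperfilter ℕ : Filter ℕ), m < n := fun m =>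
    Nat.hyperfilter_le_atTop (eventually_gt_atTop m)
  have step : ∀ m : {m // d m = c ∧ 0 < m}, ∃ n : {m // d m = c ∧ 0 < m},
      m.1 < n.1 ∧ f m.1 n.1 = c := by
    rintro ⟨m, hm, h0⟩
    obtain ⟨n, ⟨h1, h2⟩, h3⟩ := ((hc.and (hd m)).and (hgt m)).exists
    exact ⟨⟨n, h1, h0.trans h3⟩, h3, h2.trans hm⟩
  choose g hg using step
  obtain ⟨m, h1, h2⟩ := (hc.and (hgt 0)).exists
  refine ⟨fun n => (g^[n] ⟨m, h1, h2⟩).1, c, h2, strictMono_nat_of_lt_succ fun n => ?_,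
    fun n => ?_⟩
  · rw [Function.iterate_succ_apply']
    exact (hg _).1
  · simp only [Function.iterate_succ_apply']
    exact (hg _).2

/-! ### Congruences, quotients and images -/

theorem map_segProd {S T : Type u} [Mul S] [Mul T] (f : S → T)
    (hf : ∀ x y, f (x * y) = f x * f y) (a : ℕ → S) (m n : ℕ) :
    f (segProd a m n) = segProd (fun i => f (a i)) m n := by
  unfold segProd
  generalize n - m - 1 = l
  induction l with
  | zero => rfl
  | succ l ih => rw [block, hf, ih, block]

theorem segProd_rel {S : Type u} [Mul S] (r : Con S) {a b : ℕ → S} (h : ∀ n, r (a n) (b n))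
    (m n : ℕ) : r (segProd a m n) (segProd b m n) := by
  unfold segProd
  generalize n - m - 1 = l
  induction l with
  | zero => exact h m
  | succ l ih => exact r.mul ih (h _)

namespace OmegaSemigroup

/-- A congruence of an ω-semigroup: compatible equivalence relations on both sorts. -/
structure Congruence (A : OmegaSemigroup.{u}) where
  pos : Con A.Pos
  inf : Setoid A.Inf
  smul : ∀ {x y z w}, pos x y → inf z w → inf (x • z) (y • w)
  iprod : ∀ {a b : ℕ → A.Pos}, (∀ n, pos (a n) (b n)) → inf (A.iprod a) (A.iprod b)

namespace Congruence

variable {A : OmegaSemigroup.{u}} (R : Congruence A)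

theorem rel_out (x : R.pos.Quotient) (y : A.Pos) (h : (y : R.pos.Quotient) = x) :
    R.pos y (Quotient.out x) :=
  R.pos.eq.1 (h.trans (Quotient.out_eq x).symm)

/-- The quotient of an ω-semigroup by a congruence. -/
noncomputable def quotient : OmegaSemigroup.{u} where
  Pos := R.pos.Quotient
  Inf := Quotient R.inf
  semigroup := inferInstance
  action :=
    { smul := Quotient.map₂ (· • ·) fun _ _ h _ _ h' => R.smul h h'
      mul_smul := by
        rintro ⟨x⟩ ⟨y⟩ ⟨z⟩
        exact congrArg (Quotient.mk R.inf) (SemigroupAction.mul_smul x y z) }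
  -- Infinitely many representatives are chosen at once; `R.iprod` makes the class independent of
  -- the choice.
  iprod := fun a => Quotient.mk R.inf (A.iprod fun n => (a n).out)
  iprod_cons := fun a => by
    rw [A.iprod_cons]
    exact congrArg (fun q => Quotient.map₂ (· • ·) (fun _ _ h _ _ h' => R.smul h h') q
      (Quotient.mk R.inf (A.iprod fun n => (a (n + 1)).out))) (Quotient.out_eq (a 0))
  iprod_segProd := fun a k h0 hk => by
    rw [A.iprod_segProd _ k h0 hk]
    refine Quotient.sound (R.iprod fun n => R.rel_out _ _ ?_)
    rw [map_segProd (fun x : A.Pos => (x : R.pos.Quotient)) fun _ _ => rfl]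
    congr 1
    exact funext fun i => Quotient.out_eq (a i)

/-- The projection onto the quotient. -/
noncomputable def proj : Hom A R.quotient where
  pos := fun x => (x : R.pos.Quotient)
  inf := fun z => Quotient.mk R.inf z
  map_mul := fun _ _ => rfl
  map_smul := fun _ _ => rfl
  map_iprod := fun _ => Quotient.sound (R.iprod fun _ => R.rel_out _ _ rfl)

theorem proj_isSurjective : R.proj.IsSurjective :=
  ⟨Quotient.mk_surjective, Quotient.mk_surjective⟩

theorem proj_pos_eq {x y : A.Pos} : R.proj.pos x = R.proj.pos y ↔ R.pos x y := R.pos.eq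

theorem proj_inf_eq {z w : A.Inf} : R.proj.inf z = R.proj.inf w ↔ R.inf z w := Quotient.eq

end Congruence

namespace Hom

variable {A B C : OmegaSemigroup.{u}}

/-- The composite of two morphisms. -/
def comp (g : Hom B C) (f : Hom A B) : Hom A C where
  pos := g.pos ∘ f.pos
  inf := g.inf ∘ f.inf
  map_mul := fun x y => by simp [f.map_mul, g.map_mul]
  map_smul := fun x y => by simp [f.map_smul, g.map_smul]
  map_iprod := fun x => by simp [f.map_iprod, g.map_iprod]

theorem ext' {f g : Hom A B} (h : f.pos = g.pos) (h' : f.inf = g.inf) : f = g := by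
  cases f
  cases g
  cases h
  cases h'
  rfl

/-- The kernel of a morphism. -/
def ker (h : Hom A B) : Congruence A where
  pos :=
    { r := fun x y => h.pos x = h.pos y
      iseqv := ⟨fun _ => rfl, fun h => h.symm, fun h h' => h.trans h'⟩
      mul' := fun {_ _ _ _} h1 h2 => by rw [h.map_mul, h.map_mul, h1, h2] }
  inf := Setoid.ker h.inf
  smul := fun {_ _ _ _} h1 h2 => by
    change h.inf _ = h.inf _
    rw [h.map_smul, h.map_smul, show h.pos _ = h.pos _ from h1, show h.inf _ = h.inf _ from h2]
  iprod := fun {a b} h1 => by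
    change h.inf _ = h.inf _
    rw [h.map_iprod, h.map_iprod, funext (f := fun n => h.pos (a n)) h1]

/-- The kernel of `h` is contained in the kernel of `k`. -/
def Refines (h : Hom A B) (k : Hom A C) : Prop :=
  (∀ x y, h.pos x = h.pos y → k.pos x = k.pos y) ∧ ∀ z w, h.inf z = h.inf w → k.inf z = k.inf w

theorem Refines.exists_factor {h : Hom A B} {k : Hom A C} (hk : h.Refines k)
    (hs : h.IsSurjective) : ∃ q : Hom B C, q.comp h = k := by
  obtain ⟨hsp, hsi⟩ := hs
  choose s hs using hsp
  choose t ht using hsi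
  have hp : ∀ x, k.pos (s (h.pos x)) = k.pos x := fun x => hk.1 _ _ (hs _)
  have hi : ∀ x, k.inf (t (h.inf x)) = k.inf x := fun x => hk.2 _ _ (ht _)
  refine ⟨⟨k.pos ∘ s, k.inf ∘ t, fun x y => ?_, fun x z => ?_, fun a => ?_⟩,
    ext' (funext hp) (funext hi)⟩
  · rw [← hs x, ← hs y, ← h.map_mul]
    simp only [Function.comp_apply, hp, k.map_mul]
  · rw [← hs x, ← ht z, ← h.map_smul]
    simp only [Function.comp_apply, hp, hi, k.map_smul]
  · rw [show a = fun n => h.pos (s (a n)) from funext fun n => (hs _).symm, ← h.map_iprod]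
    simp only [Function.comp_apply, hp, hi, k.map_iprod]

theorem comp_refines (q : Hom B C) (h : Hom A B) : h.Refines (q.comp h) :=
  ⟨fun _ _ e => congrArg q.pos e, fun _ _ e => congrArg q.inf e⟩

theorem IsSurjective.of_comp {q : Hom B C} {h : Hom A B} (hq : (q.comp h).IsSurjective) :
    q.IsSurjective :=
  ⟨Function.Surjective.of_comp hq.1, Function.Surjective.of_comp hq.2⟩

theorem IsSurjective.isComplete {h : Hom A B} (hs : h.IsSurjective) (hA : A.IsComplete) :
    B.IsComplete := fun z => by
  obtain ⟨w, rfl⟩ := hs.2 z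
  obtain ⟨a, rfl⟩ := hA w
  exact ⟨_, (h.map_iprod a).symm⟩

theorem IsSurjective.isFinite {h : Hom A B} (hs : h.IsSurjective) (hA : A.IsFinite) :
    B.IsFinite :=
  haveI := hA.1
  haveI := hA.2
  ⟨Finite.of_surjective _ hs.1, Finite.of_surjective _ hs.2⟩

theorem IsInjective.isFinite {h : Hom A B} (hs : h.IsInjective) (hB : B.IsFinite) :
    A.IsFinite :=
  haveI := hB.1
  haveI := hB.2
  ⟨Finite.of_injective _ hs.1, Finite.of_injective _ hs.2⟩

/-- Every morphism is a surjective morphism followed by an injective one. -/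
theorem exists_image (h : Hom A B) : ∃ (C : OmegaSemigroup.{u}) (e : Hom A C) (m : Hom C B),
    e.IsSurjective ∧ m.IsInjective ∧ m.comp e = h := by
  have hs := h.ker.proj_isSurjective
  have hr : h.ker.proj.Refines h :=
    ⟨fun _ _ => h.ker.proj_pos_eq.1, fun _ _ => h.ker.proj_inf_eq.1⟩
  obtain ⟨m, hm⟩ := hr.exists_factor hs
  refine ⟨_, h.ker.proj, m, hs, ⟨?_, ?_⟩, hm⟩
  · intro x y hxy
    obtain ⟨x, rfl⟩ := hs.1 x
    obtain ⟨y, rfl⟩ := hs.1 y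
    refine h.ker.proj_pos_eq.2 ?_
    rw [← hm]
    exact hxy
  · intro x y hxy
    obtain ⟨x, rfl⟩ := hs.2 x
    obtain ⟨y, rfl⟩ := hs.2 y
    refine h.ker.proj_inf_eq.2 ?_
    rw [← hm]
    exact hxy

theorem IsInjective.refines_of_comp {h : Hom A B} {m : Hom B C} (hm : m.IsInjective) :
    (m.comp h).Refines h :=
  ⟨fun _ _ e => hm.1 e, fun _ _ e => hm.2 e⟩

theorem Refines.trans {D : OmegaSemigroup.{u}} {f : Hom A B} {g : Hom A C} {h : Hom A D}
    (h1 : f.Refines g) (h2 : g.Refines h) : f.Refines h :=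
  ⟨fun _ _ e => h2.1 _ _ (h1.1 _ _ e), fun _ _ e => h2.2 _ _ (h1.2 _ _ e)⟩

end Hom

/-- The morphism into a product given by a family of morphisms. -/
def Hom.toPi {ι : Type u} {A : ι → OmegaSemigroup.{u}} {B : OmegaSemigroup.{u}}
    (f : ∀ i, Hom B (A i)) : Hom B (pi A) where
  pos := fun x i => (f i).pos x
  inf := fun z i => (f i).inf z
  map_mul := fun x y => funext fun i => (f i).map_mul x y
  map_smul := fun x z => funext fun i => (f i).map_smul x z
  map_iprod := fun a => funext fun i => (f i).map_iprod a

/-- The projection of a product onto a factor. -/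
def piProj {ι : Type u} (A : ι → OmegaSemigroup.{u}) (i : ι) : Hom (pi A) (A i) where
  pos := fun x => x i
  inf := fun z => z i
  map_mul := fun _ _ => rfl
  map_smul := fun _ _ => rfl
  map_iprod := fun _ => rfl

theorem Hom.toPi_refines {ι : Type u} {A : ι → OmegaSemigroup.{u}} {B : OmegaSemigroup.{u}}
    (f : ∀ i, Hom B (A i)) (i : ι) : (Hom.toPi f).Refines (f i) :=
  ⟨fun _ _ e => congrFun e i, fun _ _ e => congrFun e i⟩

theorem isFinite_pi {ι : Type u} [Finite ι] {A : ι → OmegaSemigroup.{u}}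
    (hA : ∀ i, (A i).IsFinite) : (pi A).IsFinite :=
  haveI := fun i => (hA i).1
  haveI := fun i => (hA i).2
  ⟨Pi.finite, Pi.finite⟩

theorem isComplete_pi {ι : Type u} {A : ι → OmegaSemigroup.{u}}
    (hA : ∀ i, (A i).IsComplete) : (pi A).IsComplete := fun z => by
  choose a ha using fun i => hA i (z i)
  exact ⟨fun n i => a i n, funext ha⟩

end OmegaSemigroup

/-! ### Freeness of `(α⁺, α^ω)` -/

section Free

variable {α : Type u}

theorem letters_injective : Function.Injective (letters (α := α)) := by
  intro x y h
  rw [letters, letters, List.cons.injEq] at h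
  exact FreeSemigroup.ext h.1 h.2

theorem letters_block_of (z : ℕ → α) (m l : ℕ) :
    letters (block (fun n => FreeSemigroup.of (z n)) m l) =
      (List.range (l + 1)).map fun i => z (m + i) := by
  induction l with
  | zero => rfl
  | succ l ih =>
    rw [block, letters_mul, ih, List.range_succ (n := l + 1), List.map_append]
    rfl

theorem infConcat_of (z : ℕ → α) : infConcat (fun n => FreeSemigroup.of (z n)) = z := by
  refine (eq_infConcat fun n i h => ?_).symm
  simp [letters_block_of]

theorem isComplete_words (α : Type u) : (words α).IsComplete := fun z => ⟨_, infConcat_of z⟩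

/-- The position at which the `n`-th factor of `w₀ w₁ w₂ ⋯` starts. -/
def startPos (w : ℕ → FreeSemigroup α) : ℕ → ℕ
  | 0 => 0
  | n + 1 => startPos w n + (letters (w n)).length

theorem startPos_succ (w : ℕ → FreeSemigroup α) (n : ℕ) :
    startPos w (n + 1) = (letters (block w 0 n)).length := by
  induction n with
  | zero => simp [startPos, block]
  | succ n ih => rw [startPos, ih, block, letters_mul, List.length_append, zero_add]

theorem infConcat_startPos_add (w : ℕ → FreeSemigroup α) (n j : ℕ)
    (h : j < (letters (w n)).length) : infConcat w (startPos w n + j) = (letters (w n))[j] := by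
  cases n with
  | zero => simpa [startPos, block] using isPrefixOf_infConcat w 0 j (by simpa [block] using h)
  | succ n =>
    rw [isPrefixOf_infConcat w (n + 1) (startPos w (n + 1) + j)
      (by rw [← startPos_succ, startPos.eq_2 w (n + 1)]; omega)]
    simp [block, letters_mul, startPos_succ]

/-- Cutting an infinite concatenation at its start positions gives the factors back. Thus the
regrouping law of the target is all that `freeLift` needs to preserve infinite products. -/
theorem segProd_of_infConcat (w : ℕ → FreeSemigroup α) (n : ℕ) :
    segProd (fun i => FreeSemigroup.of (infConcat w i)) (startPos w n) (startPos w (n + 1)) =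
      w n := by
  refine letters_injective ?_
  have := letters_length_pos (w n)
  have hl : startPos w (n + 1) - startPos w n - 1 + 1 = (letters (w n)).length := by
    rw [startPos]
    omega
  rw [segProd, letters_block_of, hl]
  refine List.ext_getElem (by simp) fun j h1 h2 => ?_
  simp [infConcat_startPos_add w n j h2]

theorem startPos_strictMono (w : ℕ → FreeSemigroup α) : StrictMono (startPos w) :=
  strictMono_nat_of_lt_succ fun n => by
    have := letters_length_pos (w n)
    rw [startPos]
    omega

variable {A : OmegaSemigroup.{u}}

theorem iprod_prepend (f : α → A.Pos) (x : FreeSemigroup α) (z : ℕ → α) :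
    A.iprod (fun n => f (prepend x z n)) = FreeSemigroup.lift f x • A.iprod fun n => f (z n) := by
  induction x using FreeSemigroup.recOnMul generalizing z with
  | ih1 a =>
    rw [A.iprod_cons]
    simp [prepend, letters, FreeSemigroup.of, FreeSemigroup.lift]
  | ih2 x y hx hy => rw [prepend_mul, map_mul, hx, hy, SemigroupAction.mul_smul]

/-- The morphism `(α⁺, α^ω) → A` extending a map `α → A₊`. -/
def freeLift (f : α → A.Pos) : Hom (words α) A where
  pos := FreeSemigroup.lift f
  inf := fun z => A.iprod fun n => f (z n)
  map_mul := fun x y => map_mul _ x y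
  map_smul := fun x z => iprod_prepend f x z
  map_iprod := fun w => by
    rw [A.iprod_segProd _ _ rfl (startPos_strictMono w)]
    congr 1
    funext i
    conv_rhs => rw [← segProd_of_infConcat w i]
    rw [map_segProd (FreeSemigroup.lift f) (map_mul _)]
    simp only [FreeSemigroup.lift_of]
    rfl

theorem freeLift_of (f : α → A.Pos) (a : α) : (freeLift f).pos (FreeSemigroup.of a) = f a :=
  FreeSemigroup.lift_of f a

/-- Every infinite word is an infinite product of finite ones, so the second sort leaves no freedom.
-/
theorem words_hom_ext {g h : Hom (words α) A}
    (H : ∀ a : α, g.pos (FreeSemigroup.of a) = h.pos (FreeSemigroup.of a)) : g = h := by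
  have hp : ∀ x, g.pos x = h.pos x := fun x => by
    induction x using FreeSemigroup.recOnMul with
    | ih1 a => exact H a
    | ih2 x y hx hy => exact (g.map_mul _ _).trans ((congrArg₂ _ hx hy).trans (h.map_mul _ _).symm)
  refine Hom.ext' (funext hp) (funext fun z => ?_)
  obtain ⟨w, rfl⟩ := isComplete_words α z
  rw [g.map_iprod, h.map_iprod, funext fun n => hp (w n)]

/-- Morphisms from `(α⁺, α^ω)` lift along surjections. -/
theorem exists_lift {B : OmegaSemigroup.{u}} {q : Hom A B} (hq : Function.Surjective q.pos)
    (h : Hom (words α) B) : ∃ g : Hom (words α) A, q.comp g = h := by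
  choose s hs using hq
  refine ⟨freeLift fun a => s (h.pos (FreeSemigroup.of a)), words_hom_ext fun a => ?_⟩
  exact (congrArg q.pos (freeLift_of _ a)).trans (hs _)

/-- A complete ω-semigroup is generated by its first sort. -/
theorem freeLift_id_isSurjective (hA : A.IsComplete) :
    (freeLift (id : A.Pos → A.Pos)).IsSurjective :=
  ⟨fun a => ⟨FreeSemigroup.of a, freeLift_of _ a⟩, hA⟩

end Free

/-! ### Recognition by morphisms -/

section Recognition

variable {α : Type u}

open InfLanguage

/-- Being an inverse image means being saturated for the kernel; the images of the two components of
`L` serve as `Y` and `Z`. -/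
theorem isRecognizedBy_iff {L : InfLanguage α} {A : OmegaSemigroup.{u}} {h : Hom (words α) A} :
    L.IsRecognizedBy h ↔ (∀ x y, h.pos x = h.pos y → (x ∈ L.1 ↔ y ∈ L.1)) ∧
      ∀ z w, h.inf z = h.inf w → (z ∈ L.2 ↔ w ∈ L.2) := by
  constructor
  · rintro ⟨Y, Z, rfl⟩
    exact ⟨fun x y e => by simp [e], fun z w e => by simp [e]⟩
  · rintro ⟨h1, h2⟩
    refine ⟨h.pos '' L.1, h.inf '' L.2, Prod.ext (Set.ext fun x => ?_) (Set.ext fun z => ?_)⟩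
    · exact ⟨fun hx => ⟨x, hx, rfl⟩, fun ⟨y, hy, e⟩ => (h1 y x e).1 hy⟩
    · exact ⟨fun hx => ⟨z, hx, rfl⟩, fun ⟨y, hy, e⟩ => (h2 y z e).1 hy⟩

theorem InfLanguage.IsRecognizedBy.of_refines {L : InfLanguage α} {A B : OmegaSemigroup.{u}}
    {h : Hom (words α) A} {k : Hom (words α) B} (hL : L.IsRecognizedBy k) (hk : h.Refines k) :
    L.IsRecognizedBy h := by
  rw [isRecognizedBy_iff] at hL ⊢
  exact ⟨fun x y e => hL.1 x y (hk.1 x y e), fun x y e => hL.2 x y (hk.2 x y e)⟩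

theorem InfLanguage.IsRecognizedBy.preimage {β : Type u} {L : InfLanguage α}
    {A : OmegaSemigroup.{u}} {h : Hom (words α) A} (hL : L.IsRecognizedBy h)
    (g : Hom (words β) (words α)) : (L.preimage g).IsRecognizedBy (h.comp g) := by
  obtain ⟨Y, Z, rfl⟩ := hL
  exact ⟨Y, Z, rfl⟩

theorem finite_setOf_isRecognizedBy {A : OmegaSemigroup.{u}} (hA : A.IsFinite)
    (h : Hom (words α) A) : {L : InfLanguage α | L.IsRecognizedBy h}.Finite := by
  have := hA.1
  have := hA.2
  refine (Set.finite_range fun p : Set A.Pos × Set A.Inf =>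
    ((h.pos ⁻¹' p.1, h.inf ⁻¹' p.2) : InfLanguage α)).subset ?_
  rintro L ⟨Y, Z, rfl⟩
  exact ⟨(Y, Z), rfl⟩

variable {L M : InfLanguage α} {A : OmegaSemigroup.{u}} {h : Hom (words α) A}

theorem map_lmul (h : Hom (words α) A) (y : Option (words α).Pos) (x : (words α).Pos) :
    h.pos ((words α).lmul y x) = A.lmul (y.map h.pos) (h.pos x) := by
  cases y
  · rfl
  · exact h.map_mul _ _

theorem map_rmul (h : Hom (words α) A) (y : Option (words α).Pos) (x : (words α).Pos) :
    h.pos ((words α).rmul x y) = A.rmul (h.pos x) (y.map h.pos) := by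
  cases y
  · rfl
  · exact h.map_mul _ _

theorem map_lact (h : Hom (words α) A) (y : Option (words α).Pos) (z : (words α).Inf) :
    h.inf ((words α).lact y z) = A.lact (y.map h.pos) (h.inf z) := by
  cases y
  · rfl
  · exact h.map_smul _ _

theorem map_omegaPow (h : Hom (words α) A) (x : (words α).Pos) :
    h.inf ((words α).omegaPow x) = A.omegaPow (h.pos x) :=
  h.map_iprod _

namespace InfLanguage.IsRecognizedBy

theorem bot (h : Hom (words α) A) : (⊥ : InfLanguage α).IsRecognizedBy h :=
  ⟨∅, ∅, rfl⟩

theorem compl (hL : L.IsRecognizedBy h) : Lᶜ.IsRecognizedBy h := by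
  obtain ⟨Y, Z, rfl⟩ := hL
  exact ⟨Yᶜ, Zᶜ, rfl⟩

theorem sup (hL : L.IsRecognizedBy h) (hM : M.IsRecognizedBy h) : (L ⊔ M).IsRecognizedBy h := by
  obtain ⟨Y, Z, rfl⟩ := hL
  obtain ⟨Y', Z', rfl⟩ := hM
  exact ⟨Y ∪ Y', Z ∪ Z', rfl⟩

theorem inf (hL : L.IsRecognizedBy h) (hM : M.IsRecognizedBy h) : (L ⊓ M).IsRecognizedBy h := by
  obtain ⟨Y, Z, rfl⟩ := hL
  obtain ⟨Y', Z', rfl⟩ := hM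
  exact ⟨Y ∩ Y', Z ∩ Z', rfl⟩

theorem leftDeriv (hL : L.IsRecognizedBy h) (y : Option (words α).Pos) :
    (leftDeriv y L).IsRecognizedBy h := by
  obtain ⟨Y, Z, rfl⟩ := hL
  refine ⟨{a | A.lmul (y.map h.pos) a ∈ Y}, ∅, Prod.ext (Set.ext fun x => ?_) rfl⟩
  simp [InfLanguage.leftDeriv, map_lmul]

theorem rightDeriv (hL : L.IsRecognizedBy h) (y : Option (words α).Pos) :
    (rightDeriv L y).IsRecognizedBy h := by
  obtain ⟨Y, Z, rfl⟩ := hL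
  refine ⟨{a | A.rmul a (y.map h.pos) ∈ Y}, ∅, Prod.ext (Set.ext fun x => ?_) rfl⟩
  simp [InfLanguage.rightDeriv, map_rmul]

theorem infDeriv (hL : L.IsRecognizedBy h) (z : (words α).Inf) :
    (infDeriv L z).IsRecognizedBy h := by
  obtain ⟨Y, Z, rfl⟩ := hL
  refine ⟨{a | a • h.inf z ∈ Z}, ∅, Prod.ext (Set.ext fun x => ?_) rfl⟩
  simp [InfLanguage.infDeriv, h.map_smul]

theorem omegaDeriv (hL : L.IsRecognizedBy h) : (omegaDeriv L).IsRecognizedBy h := by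
  obtain ⟨Y, Z, rfl⟩ := hL
  refine ⟨{a | A.omegaPow a ∈ Z}, ∅, Prod.ext (Set.ext fun x => ?_) rfl⟩
  simp [InfLanguage.omegaDeriv, map_omegaPow]

theorem leftDerivInf (hL : L.IsRecognizedBy h) (y : Option (words α).Pos) :
    (leftDerivInf y L).IsRecognizedBy h := by
  obtain ⟨Y, Z, rfl⟩ := hL
  refine ⟨∅, {a | A.lact (y.map h.pos) a ∈ Z}, Prod.ext rfl (Set.ext fun x => ?_)⟩
  simp [InfLanguage.leftDerivInf, map_lact]

end InfLanguage.IsRecognizedBy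

/-- A directed class `R` of morphisms into finite ω-semigroups recognizes a local variety. -/
def recognizedVariety (R : ∀ A : OmegaSemigroup.{u}, Hom (words α) A → Prop)
    (fin : ∀ A h, R A h → A.IsFinite) (ne : ∃ A h, R A h)
    (dir : ∀ A h B k, R A h → R B k → ∃ C l, R C l ∧ l.Refines h ∧ l.Refines k) :
    LocalVariety α :=
  ⟨{ carrier := {L | ∃ A h, R A h ∧ L.IsRecognizedBy h}
     supClosed' := by
       rintro L ⟨A, h, hh, hL⟩ M ⟨B, k, hk, hM⟩
       obtain ⟨C, l, hl, h1, h2⟩ := dir A h B k hh hk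
       exact ⟨C, l, hl, (hL.of_refines h1).sup (hM.of_refines h2)⟩
     infClosed' := by
       rintro L ⟨A, h, hh, hL⟩ M ⟨B, k, hk, hM⟩
       obtain ⟨C, l, hl, h1, h2⟩ := dir A h B k hh hk
       exact ⟨C, l, hl, (hL.of_refines h1).inf (hM.of_refines h2)⟩
     compl_mem' := fun ⟨A, h, hh, hL⟩ => ⟨A, h, hh, hL.compl⟩
     bot_mem' := ne.imp fun _ ⟨h, hh⟩ => ⟨h, hh, .bot h⟩ },
   { regular := fun _ ⟨A, h, hh, hL⟩ => ⟨A, fin A h hh, h, hL⟩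
     leftDeriv := fun _ ⟨A, h, hh, hL⟩ y => ⟨A, h, hh, hL.leftDeriv y⟩
     rightDeriv := fun _ ⟨A, h, hh, hL⟩ y => ⟨A, h, hh, hL.rightDeriv y⟩
     infDeriv := fun _ ⟨A, h, hh, hL⟩ z => ⟨A, h, hh, hL.infDeriv z⟩
     omegaDeriv := fun _ ⟨A, h, hh, hL⟩ => ⟨A, h, hh, hL.omegaDeriv⟩
     leftDerivInf := fun _ ⟨A, h, hh, hL⟩ y => ⟨A, h, hh, hL.leftDerivInf y⟩ }⟩

end Recognition

/-! ### Separation and the syntactic quotient -/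

/-- The set `S` is a union of atoms of the Boolean algebra generated by `F`, and finiteness of `F`
leaves only finitely many atoms. -/
theorem mem_booleanSubalgebra_of_separated {X : Type*} (B : BooleanSubalgebra (Set X))
    {F : Set (Set X)} (hF : F.Finite) (hB : ∀ T ∈ F, T ∈ B) {S : Set X}
    (hS : ∀ x y, (∀ T ∈ F, x ∈ T ↔ y ∈ T) → x ∈ S → y ∈ S) : S ∈ B := by
  classical
  have := hF.to_subtype
  let c : X → Set F := fun x => {T | x ∈ T.1}
  -- The atom of `x`: the members of `F` containing `x` are intersected with the complements of the
  -- others.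
  have hc : ∀ x, (⨅ T : F, if T ∈ c x then (T : Set X) else (T : Set X)ᶜ) ∈ B := fun x =>
    B.iInf_mem fun T => by
      split_ifs
      · exact hB T T.2
      · exact BooleanSubalgebra.compl_mem (hB T T.2)
  have hfin : (Set.univ : Set (Set F)).Finite := Set.finite_univ
  have key : S = ⨆ v ∈ c '' S, ⨅ T : F, if T ∈ v then (T : Set X) else (T : Set X)ᶜ := by
    ext y
    simp only [Set.iSup_eq_iUnion, Set.iInf_eq_iInter, Set.mem_iUnion, Set.mem_iInter]
    constructor
    · intro hy
      refine ⟨c y, ⟨y, hy, rfl⟩, fun T => ?_⟩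
      split_ifs with h
      · exact h
      · exact h
    · rintro ⟨_, ⟨x, hx, rfl⟩, h⟩
      refine hS x y (fun T hT => ?_) hx
      have := h ⟨T, hT⟩
      split_ifs at this with h'
      · exact ⟨fun _ => this, fun _ => h'⟩
      · exact ⟨fun h'' => (h' h'').elim, fun h'' => (this h'').elim⟩
  rw [key]
  refine B.biSup_mem (hfin.subset (Set.subset_univ _)) ?_
  rintro _ ⟨x, -, rfl⟩
  exact hc x

namespace LocalVariety

variable {α : Type u} (W : LocalVariety α)

/-- The derivative by the empty word discards the infinite words, which allows the two sorts to be
treated separately. -/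
theorem fst_mem {L : InfLanguage α} (hL : L ∈ W.1) : ((L.1, ∅) : InfLanguage α) ∈ W.1 :=
  W.2.leftDeriv L hL none

theorem snd_mem {L : InfLanguage α} (hL : L ∈ W.1) : ((∅, L.2) : InfLanguage α) ∈ W.1 :=
  W.2.leftDerivInf L hL none

/-- The languages of finite words in a local variety. -/
def posPart : BooleanSubalgebra (Set (words α).Pos) where
  carrier := {S | ((S, ∅) : InfLanguage α) ∈ W.1}
  supClosed' := fun S hS T hT => by
    simpa using W.fst_mem (BooleanSubalgebra.sup_mem hS hT)
  infClosed' := fun S hS T hT => by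
    simpa using W.fst_mem (BooleanSubalgebra.inf_mem hS hT)
  -- The complement of `(S, ∅)` is `(Sᶜ, univ)`, so its second component must be cut off again.
  compl_mem' := fun {S} hS => W.fst_mem (BooleanSubalgebra.compl_mem hS)
  bot_mem' := W.1.bot_mem

/-- The languages of infinite words in a local variety. -/
def infPart : BooleanSubalgebra (Set (words α).Inf) where
  carrier := {S | ((∅, S) : InfLanguage α) ∈ W.1}
  supClosed' := fun S hS T hT => by
    simpa using W.snd_mem (BooleanSubalgebra.sup_mem hS hT)
  infClosed' := fun S hS T hT => by
    simpa using W.snd_mem (BooleanSubalgebra.inf_mem hS hT)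
  compl_mem' := fun {S} hS => W.snd_mem (BooleanSubalgebra.compl_mem hS)
  bot_mem' := W.1.bot_mem

theorem mem_of_separated {F : Set (InfLanguage α)} (hF : F.Finite) (hW : ∀ M ∈ F, M ∈ W.1)
    {L : InfLanguage α} (h1 : ∀ x y, (∀ M ∈ F, x ∈ M.1 ↔ y ∈ M.1) → x ∈ L.1 → y ∈ L.1)
    (h2 : ∀ z w, (∀ M ∈ F, z ∈ M.2 ↔ w ∈ M.2) → z ∈ L.2 → w ∈ L.2) : L ∈ W.1 := by
  have hp : L.1 ∈ W.posPart := mem_booleanSubalgebra_of_separated _ (hF.image Prod.fst)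
    (Set.forall_mem_image.2 fun M hM => W.fst_mem (hW M hM))
    fun x y h => h1 x y (Set.forall_mem_image.1 h)
  have hi : L.2 ∈ W.infPart := mem_booleanSubalgebra_of_separated _ (hF.image Prod.snd)
    (Set.forall_mem_image.2 fun M hM => W.snd_mem (hW M hM))
    fun x y h => h2 x y (Set.forall_mem_image.1 h)
  have h := BooleanSubalgebra.sup_mem (L := W.1) hp hi
  simpa using h

/-- All languages recognized by `h` belong to `W`. -/
def Admits {A : OmegaSemigroup.{u}} (h : Hom (words α) A) : Prop :=
  ∀ L : InfLanguage α, L.IsRecognizedBy h → L ∈ W.1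

variable {W}

theorem Admits.of_refines {A B : OmegaSemigroup.{u}} {h : Hom (words α) A}
    {k : Hom (words α) B} (hh : W.Admits h) (hk : h.Refines k) : W.Admits k :=
  fun _ hL => hh _ (hL.of_refines hk)

theorem Admits.of_jointly_refines {ι : Type*} [Finite ι] {A : ι → OmegaSemigroup.{u}}
    {f : ∀ i, Hom (words α) (A i)} (hA : ∀ i, (A i).IsFinite) (hf : ∀ i, W.Admits (f i))
    {B : OmegaSemigroup.{u}} {h : Hom (words α) B}
    (h1 : ∀ x y, (∀ i, (f i).pos x = (f i).pos y) → h.pos x = h.pos y)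
    (h2 : ∀ z w, (∀ i, (f i).inf z = (f i).inf w) → h.inf z = h.inf w) : W.Admits h := by
  intro L hL
  rw [isRecognizedBy_iff] at hL
  refine W.mem_of_separated (F := ⋃ i, {M | M.IsRecognizedBy (f i)})
    (Set.finite_iUnion fun i => finite_setOf_isRecognizedBy (hA i) (f i)) ?_ ?_ ?_
  · intro M hM
    obtain ⟨i, hi⟩ := Set.mem_iUnion.1 hM
    exact hf i M hi
  · refine fun x y hxy => (hL.1 x y (h1 x y fun i => ?_)).1
    -- The separating language is the inverse image of the single point `(f i).pos x`.
    exact ((hxy _ (Set.mem_iUnion.2 ⟨i, {(f i).pos x}, ∅, rfl⟩)).1 rfl).symm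
  · refine fun x y hxy => (hL.2 x y (h2 x y fun i => ?_)).1
    exact ((hxy _ (Set.mem_iUnion.2 ⟨i, ∅, {(f i).inf x}, rfl⟩)).1 rfl).symm

theorem Admits.toPi {ι : Type u} [Finite ι] {A : ι → OmegaSemigroup.{u}}
    {f : ∀ i, Hom (words α) (A i)} (hA : ∀ i, (A i).IsFinite) (hf : ∀ i, W.Admits (f i)) :
    W.Admits (Hom.toPi f) :=
  .of_jointly_refines hA hf (fun _ _ h => funext h) fun _ _ h => funext h

variable (W)

/-- A set of languages is closed under derivatives. -/
structure DerivClosed (D : Set (InfLanguage α)) : Prop where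
  leftDeriv : ∀ L ∈ D, ∀ y, InfLanguage.leftDeriv y L ∈ D
  rightDeriv : ∀ L ∈ D, ∀ y, InfLanguage.rightDeriv L y ∈ D
  infDeriv : ∀ L ∈ D, ∀ z, InfLanguage.infDeriv L z ∈ D
  omegaDeriv : ∀ L ∈ D, InfLanguage.omegaDeriv L ∈ D
  leftDerivInf : ∀ L ∈ D, ∀ y, InfLanguage.leftDerivInf y L ∈ D

theorem derivClosed_recognized {A : OmegaSemigroup.{u}} (h : Hom (words α) A) :
    DerivClosed {L | L ∈ W.1 ∧ L.IsRecognizedBy h} where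
  leftDeriv := fun L hL y => ⟨W.2.leftDeriv L hL.1 y, hL.2.leftDeriv y⟩
  rightDeriv := fun L hL y => ⟨W.2.rightDeriv L hL.1 y, hL.2.rightDeriv y⟩
  infDeriv := fun L hL z => ⟨W.2.infDeriv L hL.1 z, hL.2.infDeriv z⟩
  omegaDeriv := fun L hL => ⟨W.2.omegaDeriv L hL.1, hL.2.omegaDeriv⟩
  leftDerivInf := fun L hL y => ⟨W.2.leftDerivInf L hL.1 y, hL.2.leftDerivInf y⟩

end LocalVariety

section Syntactic

variable {α : Type u}

/-- Two infinite products of finite words, taken in a finite ω-semigroup, are of the form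
`s e^ω` and `s' e'^ω` for one common factorization. -/
theorem exists_common_factorization {A : OmegaSemigroup.{u}} (hA : A.IsFinite)
    (h : Hom (words α) A) (a b : ℕ → (words α).Pos) :
    ∃ k m : ℕ,
      h.inf ((words α).iprod a) =
        h.inf (segProd a 0 k • (words α).omegaPow (segProd a k m)) ∧
      h.inf ((words α).iprod b) =
        h.inf (segProd b 0 k • (words α).omegaPow (segProd b k m)) := by
  have := hA.1
  -- Colouring by pairs makes one sequence of cuts work for `a` and `b` simultaneously.
  obtain ⟨k, c, h0, hk, hc⟩ := exists_strictMono_monochromatic fun m n =>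
    (h.pos (segProd a m n), h.pos (segProd b m n))
  -- The regrouping law wants the first cut at `0`; `0 < k 0` keeps the initial segment nonempty.
  let k' : ℕ → ℕ := fun n => Nat.casesOn n 0 k
  have hk' : StrictMono k' := strictMono_nat_of_lt_succ fun n => by
    cases n with
    | zero => exact h0
    | succ n => exact hk n.lt_succ_self
  have key : ∀ d : ℕ → (words α).Pos,
      (∀ i, h.pos (segProd d (k i) (k (i + 1))) = h.pos (segProd d (k 0) (k 1))) →
      h.inf ((words α).iprod d) =
        h.inf (segProd d 0 (k 0) • (words α).omegaPow (segProd d (k 0) (k 1))) := by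
    intro d hd
    rw [(words α).iprod_segProd d k' rfl hk', (words α).iprod_cons, h.map_smul, h.map_smul,
      h.map_iprod, map_omegaPow]
    exact congrArg (fun e => h.pos (segProd d 0 (k 0)) • A.iprod e) (funext hd)
  exact ⟨k 0, k 1, key a fun i => congrArg Prod.fst ((hc i).trans (hc 0).symm),
    key b fun i => congrArg Prod.snd ((hc i).trans (hc 0).symm)⟩

/-- The syntactic congruence of a set of languages that are recognized by one finite
ω-semigroup and closed under derivatives. -/
def syntacticCongruence {D : Set (InfLanguage α)} (hD : LocalVariety.DerivClosed D)
    {A : OmegaSemigroup.{u}} (hA : A.IsFinite) (h : Hom (words α) A)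
    (hh : ∀ L ∈ D, L.IsRecognizedBy h) : Congruence (words α) :=
  let pos : Con (words α).Pos :=
    { r := fun x y => ∀ M ∈ D, x ∈ M.1 ↔ y ∈ M.1
      iseqv := ⟨fun _ _ _ => Iff.rfl, fun h M hM => (h M hM).symm,
        fun h h' M hM => (h M hM).trans (h' M hM)⟩
      mul' := fun {_ y z _} h1 h2 M hM =>
        (h1 _ (hD.rightDeriv M hM (some z))).trans (h2 _ (hD.leftDeriv M hM (some y))) }
  let inf : Setoid (words α).Inf :=
    { r := fun x y => ∀ M ∈ D, x ∈ M.2 ↔ y ∈ M.2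
      iseqv := ⟨fun _ _ _ => Iff.rfl, fun h M hM => (h M hM).symm,
        fun h h' M hM => (h M hM).trans (h' M hM)⟩ }
  have smul : ∀ {x y z w}, pos x y → inf z w → inf (x • z) (y • w) :=
    fun {_ y z _} h1 h2 M hM =>
      (h1 _ (hD.infDeriv M hM z)).trans (h2 _ (hD.leftDerivInf M hM (some y)))
  { pos := pos
    inf := inf
    smul := smul
    iprod := fun {a b} hab M hM => by
      -- Since `M` only sees values of `h`, both products may be replaced by their factorized forms.
      -- Corresponding finite segments are congruent, and the ω-derivative carries this over to
      -- their ω-powers.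
      obtain ⟨k, m, ha, hb⟩ := exists_common_factorization hA h a b
      have hM' := (isRecognizedBy_iff.1 (hh M hM)).2
      rw [hM' _ _ ha, hM' _ _ hb]
      exact smul (segProd_rel pos hab 0 k)
        (fun N hN => segProd_rel pos hab k m _ (hD.omegaDeriv N hN)) M hM }

/-- Every language in a local variety is recognized by a finite quotient all of whose languages
belong to the local variety. -/
theorem LocalVariety.exists_generatedAlgebra (W : LocalVariety α) {L : InfLanguage α}
    (hL : L ∈ W.1) : ∃ e : GeneratedAlgebra α, L.IsRecognizedBy e.map ∧ W.Admits e.map := by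
  obtain ⟨A, hA, h, hLh⟩ := W.2.regular L hL
  let R := syntacticCongruence (W.derivClosed_recognized h) hA h fun _ hM => hM.2
  -- As `h` may fail to be surjective, its finite image is used: the syntactic quotient is a
  -- quotient of it, hence finite.
  obtain ⟨C, e, m, he, hm, rfl⟩ := h.exists_image
  have hr : e.Refines R.proj :=
    ⟨fun x y hxy => R.proj_pos_eq.2 fun M hM =>
        (isRecognizedBy_iff.1 hM.2).1 x y (congrArg m.pos hxy),
      fun x y hxy => R.proj_inf_eq.2 fun M hM =>
        (isRecognizedBy_iff.1 hM.2).2 x y (congrArg m.inf hxy)⟩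
  obtain ⟨q, hq⟩ := hr.exists_factor he
  have hs := R.proj_isSurjective
  have hqs : q.IsSurjective := Hom.IsSurjective.of_comp (hq ▸ hs)
  refine ⟨⟨R.quotient, hqs.isFinite (hm.isFinite hA), R.proj, hs⟩, ?_, fun M hM => ?_⟩
  · exact isRecognizedBy_iff.2 ⟨fun x y hxy => R.proj_pos_eq.1 hxy L ⟨hL, hLh⟩,
      fun x y hxy => R.proj_inf_eq.1 hxy L ⟨hL, hLh⟩⟩
  · rw [isRecognizedBy_iff] at hM
    exact W.mem_of_separated ((finite_setOf_isRecognizedBy hA (m.comp e)).subset fun _ h => h.2)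
      (fun _ h => h.1) (fun x y hxy => (hM.1 x y (R.proj_pos_eq.2 hxy)).1)
      fun x y hxy => (hM.2 x y (R.proj_inf_eq.2 hxy)).1

end Syntactic

/-! ### The local correspondence -/

section LocalCorrespondence

variable {α : Type u}

theorem GeneratedAlgebra.le_iff {e e' : GeneratedAlgebra α} : e ≤ e' ↔ e'.map.Refines e.map := by
  constructor
  · rintro ⟨q, h1, h2⟩
    have h := Hom.comp_refines q e'.map
    rwa [Hom.ext' (f := q.comp e'.map) (g := e.map) (funext fun x => (h1 x).symm)
      (funext fun x => (h2 x).symm)] at h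
  · intro h
    obtain ⟨q, hq⟩ := h.exists_factor e'.surjective
    exact ⟨q, congrFun (congrArg Hom.pos hq.symm), congrFun (congrArg Hom.inf hq.symm)⟩

/-- The subdirect product of a finite family of quotients. -/
theorem GeneratedAlgebra.exists_subdirect {ι : Type u} [Finite ι] (s : ι → GeneratedAlgebra α) :
    ∃ e : GeneratedAlgebra α, (∀ i, s i ≤ e) ∧
      ∀ W : LocalVariety α, (∀ i, W.Admits (s i).map) → W.Admits e.map := by
  -- Injectivity of `m` gives `e` the kernel of the tuple, which is the intersection of the kernels
  -- of the `s i`.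
  obtain ⟨C, e, m, he, hm, h⟩ := (Hom.toPi fun i => (s i).map).exists_image
  refine ⟨⟨C, hm.isFinite (isFinite_pi fun i => (s i).finite), e, he⟩, fun i => ?_,
    fun W hW => ?_⟩
  · have hr := Hom.comp_refines m e
    rw [h] at hr
    exact le_iff.2 (hr.trans (Hom.toPi_refines _ i))
  · have hr := hm.refines_of_comp (h := e)
    rw [h] at hr
    exact (LocalVariety.Admits.toPi (fun i => (s i).finite) hW).of_refines hr

variable (α) in
theorem nonempty_generatedAlgebra :
    ∃ e : GeneratedAlgebra α, ∀ W : LocalVariety α, W.Admits e.map :=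
  have ⟨e, _, h⟩ := GeneratedAlgebra.exists_subdirect (α := α) (ι := PEmpty) nofun
  ⟨e, fun W => h W nofun⟩

theorem GeneratedAlgebra.exists_sup (e e' : GeneratedAlgebra α) :
    ∃ f : GeneratedAlgebra α, e ≤ f ∧ e' ≤ f ∧
      ∀ W : LocalVariety α, W.Admits e.map → W.Admits e'.map → W.Admits f.map := by
  obtain ⟨f, h, hW⟩ := exists_subdirect fun b : ULift.{u} Bool => cond b.down e e'
  refine ⟨f, h ⟨true⟩, h ⟨false⟩, fun W h1 h2 => hW W ?_⟩
  rintro ⟨_ | _⟩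
  exacts [h2, h1]

/-- The local pseudovariety of the quotients that recognize only members of `W`. -/
def LocalVariety.pseudovariety (W : LocalVariety α) : LocalPseudovariety α where
  carrier := {e | W.Admits e.map}
  lower' := fun _ _ h h' => LocalVariety.Admits.of_refines h' (GeneratedAlgebra.le_iff.1 h)
  nonempty' := (nonempty_generatedAlgebra α).imp fun _ h => h W
  directed' := fun e he e' he' => by
    obtain ⟨f, h1, h2, h⟩ := e.exists_sup e'
    exact ⟨f, h W he he', h1, h2⟩

/-- The local variety of the languages recognized by the members of a local pseudovariety. -/
def localVarietyOf (P : LocalPseudovariety α) : LocalVariety α :=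
  -- The transport along `p` only says that `(A, h)` is the underlying pair of a member of `P`.
  recognizedVariety (fun A h => ∃ e ∈ P, ∃ p : e.alg = A, p ▸ e.map = h)
    (by
      rintro A h ⟨e, -, rfl, -⟩
      exact e.finite)
    (by
      obtain ⟨e, he⟩ := P.nonempty
      exact ⟨_, _, e, he, rfl, rfl⟩)
    (by
      rintro _ _ _ _ ⟨e, he, rfl, rfl⟩ ⟨e', he', rfl, rfl⟩
      obtain ⟨f, hf, h1, h2⟩ := P.directed e he e' he'
      exact ⟨_, _, ⟨f, hf, rfl, rfl⟩, GeneratedAlgebra.le_iff.1 h1, GeneratedAlgebra.le_iff.1 h2⟩)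

theorem mem_localVarietyOf {P : LocalPseudovariety α} {L : InfLanguage α} :
    L ∈ (localVarietyOf P).1 ↔ ∃ e ∈ P, L.IsRecognizedBy e.map := by
  constructor
  · rintro ⟨_, _, ⟨e, he, rfl, rfl⟩, hL⟩
    exact ⟨e, he, hL⟩
  · rintro ⟨e, he, hL⟩
    exact ⟨_, _, ⟨e, he, rfl, rfl⟩, hL⟩

theorem localVarietyOf_pseudovariety (W : LocalVariety α) :
    localVarietyOf W.pseudovariety = W := by
  refine Subtype.ext (SetLike.ext fun L => mem_localVarietyOf.trans ⟨?_, fun hL => ?_⟩)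
  · rintro ⟨e, he, hL⟩
    exact he L hL
  · obtain ⟨e, h1, h2⟩ := W.exists_generatedAlgebra hL
    exact ⟨e, h2, h1⟩

/-- A morphism into a finite ω-semigroup is refined by a morphism recognizing the inverse images
of its points. -/
theorem refines_of_isRecognizedBy {A B : OmegaSemigroup.{u}} {h : Hom (words α) A}
    {k : Hom (words α) B} (h1 : ∀ a, InfLanguage.IsRecognizedBy (h.pos ⁻¹' {a}, ∅) k)
    (h2 : ∀ a, InfLanguage.IsRecognizedBy (∅, h.inf ⁻¹' {a}) k) : k.Refines h :=
  ⟨fun x y e => (((isRecognizedBy_iff.1 (h1 (h.pos x))).1 x y e).1 rfl).symm,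
    fun x y e => (((isRecognizedBy_iff.1 (h2 (h.inf x))).2 x y e).1 rfl).symm⟩

theorem pseudovariety_localVarietyOf (P : LocalPseudovariety α) :
    (localVarietyOf P).pseudovariety = P := by
  refine SetLike.ext fun e => ⟨fun he => ?_, fun he L hL => mem_localVarietyOf.2 ⟨e, he, hL⟩⟩
  have := e.finite.1
  have := e.finite.2
  choose f hf hf' using fun a : e.alg.Pos => mem_localVarietyOf.1 (he _ ⟨{a}, ∅, rfl⟩)
  choose g hg hg' using fun a : e.alg.Inf => mem_localVarietyOf.1 (he _ ⟨∅, {a}, rfl⟩)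
  have : Nonempty P := P.nonempty.to_subtype
  -- Both sorts are finite, so directedness yields one `u` in `P` above the quotients chosen for all
  -- the points.
  obtain ⟨⟨u, hu⟩, hle⟩ := P.directed.directed_val.finite_le
    (Sum.elim (fun a => (⟨f a, hf a⟩ : P)) fun a => ⟨g a, hg a⟩)
  refine P.lower (GeneratedAlgebra.le_iff.2 (refines_of_isRecognizedBy (fun a => ?_)
    fun a => ?_)) hu
  · exact (hf' a).of_refines (GeneratedAlgebra.le_iff.1 (hle (.inl a)))
  · exact (hg' a).of_refines (GeneratedAlgebra.le_iff.1 (hle (.inr a)))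

/-- The isomorphism between local pseudovarieties and local varieties. -/
def localCorrespondence (α : Type u) : LocalPseudovariety α ≃o LocalVariety α where
  toFun := localVarietyOf
  invFun := LocalVariety.pseudovariety
  left_inv := pseudovariety_localVarietyOf
  right_inv := localVarietyOf_pseudovariety
  map_rel_iff' := by
    intro P Q
    change localVarietyOf P ≤ localVarietyOf Q ↔ P ≤ Q
    constructor
    · intro h
      rw [← pseudovariety_localVarietyOf P, ← pseudovariety_localVarietyOf Q]
      exact fun e he L hL => h (he L hL)
    · intro h L hL
      rw [mem_localVarietyOf] at hL
      obtain ⟨e, he, hL⟩ := hL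
      exact mem_localVarietyOf.2 ⟨e, h he, hL⟩

end LocalCorrespondence

/-! ### The global correspondence -/

section Correspondence

/-- Two morphisms are refined by one morphism into the product of their codomains. -/
theorem IsPseudovariety.exists_refines {V : Set OmegaSemigroup.{u}} (hV : IsPseudovariety V)
    {α : Type u} {A B : OmegaSemigroup.{u}} (hA : A ∈ V) (hB : B ∈ V) (h : Hom (words α) A)
    (k : Hom (words α) B) :
    ∃ C ∈ V, ∃ l : Hom (words α) C, l.Refines h ∧ l.Refines k := by
  let s : ULift.{u} Bool → Σ A : OmegaSemigroup.{u}, Hom (words α) A :=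
    fun b => cond b.down ⟨A, h⟩ ⟨B, k⟩
  refine ⟨_, hV.prod (ULift.{u} Bool) (fun b => (s b).1) ?_, Hom.toPi fun b => (s b).2,
    Hom.toPi_refines (fun b => (s b).2) ⟨true⟩, Hom.toPi_refines (fun b => (s b).2) ⟨false⟩⟩
  rintro ⟨_ | _⟩
  exacts [hB, hA]

/-- The variety of the languages recognized by the members of a pseudovariety. -/
def varietyOf (V : Pseudovariety.{u}) : Variety.{u} :=
  ⟨fun α => recognizedVariety (fun A _ => A ∈ V.1) (fun A _ hA => V.2.finite A hA)
      -- The empty product guarantees that some morphism into a member of `V` exists.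
      ⟨_, Hom.toPi (ι := PEmpty.{u + 1}) (A := nofun) nofun, V.2.prod PEmpty _ nofun⟩
      fun _ h _ k hA hB => by
        obtain ⟨C, hC, l, hl⟩ := V.2.exists_refines hA hB h k
        exact ⟨C, l, hC, hl⟩,
    fun _ _ g _ ⟨A, h, hA, hL⟩ => ⟨A, h.comp g, hA, hL.preimage g⟩⟩

theorem mem_varietyOf {V : Pseudovariety.{u}} {α : Alphabet.{u}} {L : InfLanguage α.1} :
    L ∈ ((varietyOf V).1 α).1 ↔
      ∃ A ∈ V.1, ∃ h : Hom (words α.1) A, L.IsRecognizedBy h :=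
  ⟨fun ⟨A, h, hA, hL⟩ => ⟨A, hA, h, hL⟩, fun ⟨A, hA, h, hL⟩ => ⟨A, h, hA, hL⟩⟩

theorem Hom.admits_comp {W : Variety.{u}} {α β : Alphabet.{u}} {A : OmegaSemigroup.{u}}
    {e : Hom (words α.1) A} (he : (W.1 α).Admits e) (g : Hom (words β.1) (words α.1)) :
    (W.1 β).Admits (e.comp g) := by
  rintro L ⟨Y, Z, rfl⟩
  exact W.2 α β g _ (he _ ⟨Y, Z, rfl⟩)

/-- The pseudovariety of the finite complete ω-semigroups that recognize only members of `W`. -/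
def pseudovarietyOf (W : Variety.{u}) : Pseudovariety.{u} :=
  ⟨{A | A.IsFinite ∧ A.IsComplete ∧ ∀ (α : Alphabet.{u}) (h : Hom (words α.1) A),
      (W.1 α).Admits h},
    { finite := fun _ hA => hA.1
      complete := fun _ hA => hA.2.1
      quotient := by
        intro A hA B q hq
        refine ⟨hq.isFinite hA.1, hq.isComplete hA.2.1, fun α h => ?_⟩
        -- Lifting `h` to `A` shows that whatever it recognizes is already recognized by a morphism
        -- into `A`.
        obtain ⟨g, rfl⟩ := exists_lift hq.1 h
        exact (hA.2.2 α g).of_refines (Hom.comp_refines q g)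
      sub := fun A hA B m hm hB => ⟨hm.isFinite hA.1, hB, fun α h =>
        (hA.2.2 α (m.comp h)).of_refines hm.refines_of_comp⟩
      prod := fun ι _ A hA => ⟨isFinite_pi fun i => (hA i).1, isComplete_pi fun i => (hA i).2.1,
        fun α h => LocalVariety.Admits.toPi (f := fun i => (piProj A i).comp h)
          (fun i => (hA i).1) fun i => (hA i).2.2 α _⟩ }⟩

theorem varietyOf_pseudovarietyOf (W : Variety.{u}) : varietyOf (pseudovarietyOf W) = W := by
  refine Subtype.ext (funext fun α => Subtype.ext (SetLike.ext fun L =>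
    mem_varietyOf.trans ⟨?_, fun hL => ?_⟩))
  · rintro ⟨A, hA, h, hL⟩
    exact hA.2.2 α h L hL
  · obtain ⟨e, h1, h2⟩ := (W.1 α).exists_generatedAlgebra hL
    refine ⟨e.alg, ⟨e.finite, e.surjective.isComplete (isComplete_words _), fun β h => ?_⟩,
      e.map, h1⟩
    obtain ⟨g, rfl⟩ := exists_lift e.surjective.1 h
    exact Hom.admits_comp h2 g

theorem pseudovarietyOf_varietyOf (V : Pseudovariety.{u}) : pseudovarietyOf (varietyOf V) = V := by
  refine Subtype.ext (Set.ext fun A => ⟨fun hA => ?_, fun hA => ⟨V.2.finite A hA,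
    V.2.complete A hA, fun α h L hL => mem_varietyOf.2 ⟨A, hA, h, hL⟩⟩⟩)
  obtain ⟨hfin, hcomp, hA⟩ := hA
  have := hfin.1
  have := hfin.2
  -- Finiteness makes `A.Pos` a legitimate alphabet; completeness makes `h` surjective on the second
  -- sort.
  let h : Hom (words A.Pos) A := freeLift id
  have hs : h.IsSurjective := freeLift_id_isSurjective hcomp
  choose B hB f hf using fun a : A.Pos =>
    mem_varietyOf.1 (hA ⟨A.Pos, hfin.1⟩ h _ ⟨{a}, ∅, rfl⟩)
  choose C hC g hg using fun a : A.Inf =>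
    mem_varietyOf.1 (hA ⟨A.Pos, hfin.1⟩ h _ ⟨∅, {a}, rfl⟩)
  let s : A.Pos ⊕ A.Inf → Σ D : OmegaSemigroup.{u}, Hom (words A.Pos) D :=
    Sum.elim (fun a => ⟨B a, f a⟩) fun a => ⟨C a, g a⟩
  have hV : pi (fun i => (s i).1) ∈ V.1 := V.2.prod _ _ (Sum.rec hB hC)
  obtain ⟨D, e, m, he, hm, hme⟩ := (Hom.toPi fun i => (s i).2).exists_image
  -- Only complete ω-subsemigroups are allowed here; `D` is complete as an image of words.
  have hD : D ∈ V.1 := V.2.sub _ hV D m hm (he.isComplete (isComplete_words _))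
  have hr : e.Refines h := by
    have hr := (Hom.comp_refines m e)
    rw [hme] at hr
    refine hr.trans (refines_of_isRecognizedBy (fun a => ?_) fun a => ?_)
    · exact InfLanguage.IsRecognizedBy.of_refines (k := f a) (hf a)
        (Hom.toPi_refines (fun i => (s i).2) (.inl a))
    · exact InfLanguage.IsRecognizedBy.of_refines (k := g a) (hg a)
        (Hom.toPi_refines (fun i => (s i).2) (.inr a))
  obtain ⟨q, hq⟩ := hr.exists_factor he
  exact V.2.quotient D hD A q (Hom.IsSurjective.of_comp (hq ▸ hs))

/-- The isomorphism between pseudovarieties and varieties. -/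
def correspondence : Pseudovariety.{u} ≃o Variety.{u} where
  toFun := varietyOf
  invFun := pseudovarietyOf
  left_inv := pseudovarietyOf_varietyOf
  right_inv := varietyOf_pseudovarietyOf
  map_rel_iff' := by
    intro V V'
    change varietyOf V ≤ varietyOf V' ↔ V ≤ V'
    constructor
    · intro h
      rw [← pseudovarietyOf_varietyOf V, ← pseudovarietyOf_varietyOf V']
      exact fun A hA => ⟨hA.1, hA.2.1, fun α k L hL => h α (hA.2.2 α k L hL)⟩
    · intro h α L hL
      obtain ⟨A, hA, k, hL⟩ := mem_varietyOf.1 hL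
      exact mem_varietyOf.2 ⟨A, h hA, k, hL⟩

end Correspondence

/-! ### Lattice structure -/

theorem IsLatticeOrder.of_orderIso {P Q : Type*} [PartialOrder P] [PartialOrder Q] (f : P ≃o Q)
    (h : IsLatticeOrder P) : IsLatticeOrder Q := by
  intro a b
  obtain ⟨⟨c, hc⟩, d, hd⟩ := h (f.symm a) (f.symm b)
  refine ⟨⟨f c, ?_⟩, f d, ?_⟩
  · simpa [Set.image_pair] using f.isLUB_image'.2 hc
  · simpa [Set.image_pair] using f.isGLB_image'.2 hd

/-- A join is the meet of the upper bounds, a nonempty set thanks to `top`. Nonempty meets suffice,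
which matters because an empty intersection would lose regularity or finiteness. -/
theorem isLatticeOrder_of_isGLB {P : Type*} [PartialOrder P] (top : P) (htop : ∀ a, a ≤ top)
    (h : ∀ S : Set P, S.Nonempty → ∃ c, IsGLB S c) : IsLatticeOrder P := by
  intro a b
  obtain ⟨c, hc⟩ := h (upperBounds {a, b}) ⟨top, fun x _ => htop x⟩
  exact ⟨⟨c, isGLB_upperBounds.1 hc⟩, h _ (Set.insert_nonempty _ _)⟩

theorem exists_isGLB_localVariety {α : Type u} (S : Set (LocalVariety α)) (hS : S.Nonempty) :
    ∃ c, IsGLB S c := by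
  obtain ⟨W₀, h₀⟩ := hS
  refine ⟨⟨⨅ W ∈ S, W.1, ?_⟩, ?_, ?_⟩
  · constructor <;> simp only [BooleanSubalgebra.mem_iInf]
    · exact fun L hL => W₀.2.regular L (hL W₀ h₀)
    · exact fun L hL y W hW => W.2.leftDeriv L (hL W hW) y
    · exact fun L hL y W hW => W.2.rightDeriv L (hL W hW) y
    · exact fun L hL z W hW => W.2.infDeriv L (hL W hW) z
    · exact fun L hL W hW => W.2.omegaDeriv L (hL W hW)
    · exact fun L hL y W hW => W.2.leftDerivInf L (hL W hW) y
  · intro W hW L hL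
    simp only [BooleanSubalgebra.mem_iInf] at hL
    exact hL W hW
  · intro W hW L hL
    simp only [BooleanSubalgebra.mem_iInf]
    exact fun W' hW' => hW hW' hL

theorem isLatticeOrder_localVariety (α : Type u) : IsLatticeOrder (LocalVariety α) := by
  -- The largest local variety is obtained as the image of the ideal of all finite quotients.
  let top : LocalPseudovariety α :=
    { carrier := Set.univ
      lower' := fun _ _ _ _ => trivial
      nonempty' := (nonempty_generatedAlgebra α).imp fun _ _ => trivial
      directed' := fun e _ e' _ => by
        obtain ⟨f, h1, h2, -⟩ := e.exists_sup e'
        exact ⟨f, trivial, h1, h2⟩ }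
  refine isLatticeOrder_of_isGLB (localCorrespondence α top) (fun W => ?_)
    exists_isGLB_localVariety
  rw [← (localCorrespondence α).symm_apply_le]
  exact fun _ _ => trivial

theorem isLatticeOrder_pseudovariety : IsLatticeOrder Pseudovariety.{u} := by
  let top : Pseudovariety.{u} :=
    ⟨{A | A.IsFinite ∧ A.IsComplete},
      { finite := fun _ hA => hA.1
        complete := fun _ hA => hA.2
        quotient := fun A hA B q hq => ⟨hq.isFinite hA.1, hq.isComplete hA.2⟩
        sub := fun A hA B m hm hB => ⟨hm.isFinite hA.1, hB⟩
        prod := fun ι _ A hA => ⟨isFinite_pi fun i => (hA i).1,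
          isComplete_pi fun i => (hA i).2⟩ }⟩
  refine isLatticeOrder_of_isGLB top (fun V A hA => ⟨V.2.finite A hA, V.2.complete A hA⟩) ?_
  rintro S ⟨V₀, h₀⟩
  refine ⟨⟨{A | ∀ V ∈ S, A ∈ V.1},
    { finite := fun A hA => V₀.2.finite A (hA V₀ h₀)
      complete := fun A hA => V₀.2.complete A (hA V₀ h₀)
      quotient := fun A hA B q hq V hV => V.2.quotient A (hA V hV) B q hq
      sub := fun A hA B m hm hB V hV => V.2.sub A (hA V hV) B m hm hB
      prod := fun ι _ A hA V hV => V.2.prod ι A fun i => hA i V hV }⟩, ?_, ?_⟩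
  · exact fun V hV A hA => hA V hV
  · exact fun V hV A hA V' hV' => hV hV' hA

end InftyLang

/-- The lattice of (local) varieties of ∞-languages is isomorphic to the lattice of (local)
pseudovarieties of ω-semigroups, the isomorphism sending a (local) pseudovariety to the
∞-languages recognized by its members. -/
theorem mainTheorem9 :
    (∀ (α : Type u) [Finite α],
      InftyLang.IsLatticeOrder (InftyLang.LocalVariety α) ∧
      InftyLang.IsLatticeOrder (InftyLang.LocalPseudovariety α) ∧
      ∃ Φ : InftyLang.LocalPseudovariety α ≃o InftyLang.LocalVariety α,
        ∀ (P : InftyLang.LocalPseudovariety α) (L : InftyLang.InfLanguage α),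
          L ∈ (Φ P).1 ↔ ∃ e ∈ P, L.IsRecognizedBy e.map) ∧
    InftyLang.IsLatticeOrder InftyLang.Variety.{u} ∧
    InftyLang.IsLatticeOrder InftyLang.Pseudovariety.{u} ∧
    ∃ Ψ : InftyLang.Pseudovariety.{u} ≃o InftyLang.Variety.{u},
      ∀ (V : InftyLang.Pseudovariety.{u}) (α : InftyLang.Alphabet.{u})
        (L : InftyLang.InfLanguage α.1),
        L ∈ ((Ψ V).1 α).1 ↔
          ∃ A ∈ V.1, ∃ h : InftyLang.OmegaSemigroup.Hom (InftyLang.words α.1) A,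
            L.IsRecognizedBy h := by
  exact ⟨fun α _ => ⟨InftyLang.isLatticeOrder_localVariety α,
      (InftyLang.isLatticeOrder_localVariety α).of_orderIso (InftyLang.localCorrespondence α).symm,
      InftyLang.localCorrespondence α, fun _ _ => InftyLang.mem_localVarietyOf⟩,
    InftyLang.isLatticeOrder_pseudovariety.of_orderIso InftyLang.correspondence,
    InftyLang.isLatticeOrder_pseudovariety, InftyLang.correspondence,
    fun _ _ _ => InftyLang.mem_varietyOf⟩
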